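/- Identify $M_k\otimes M_m$ (complex matrices) with $M_{km}$ via the Kronecker product, and equip $M_k$ and $M_m$ with the inner product $\langle C,D\rangle=\operatorname{tr}(CD^*)$. A Hermitian Schmidt decomposition of $A\in M_k\otimes M_m$ is an expression $A=\sum_{i=1}^n\lambda_i\,\gamma_i\otimes\delta_i$ with $\lambda_i>0$ real, $\gamma_1,\dots,\gamma_n\in M_k$ orthonormal and Hermitian, and $\delta_1,\dots,\delta_n\in M_m$ orthonormal and Hermitian (for $A=0$, the empty sum). A positive semidefinite Hermitian matrix $A$ is called - SPC (symmetric with positive coefficients) if $k=m$ and $A$ has a Hermitian Schmidt decomposition of the form $A=\sum_{i=1}^n\lambda_i\,\gamma_i\otimes\gamma_i$ (with all $\lambda_i>0$); - PPT if its partial transpose $\big((\cdot)^t\otimes \mathrm{Id}\big)(A)$ is also a positive semidefinite Hermitian matrix; - weak irreducible if, for all Hermitian projections $V_1,V_2\in M_k$ and $W_1,W_2\in M_m$ with $V_1V_2=0$, $W_1W_2=0$, $V_1+V_2=\mathrm{Id}$, $W_1+W_2=\mathrm{Id}$, the equality $A=\sum_{i=1}^2 (V_i\otimes W_i)A(V_i\otimes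 W_i)$ implies $(V_1\otimes W_1)A(V_1\otimes W_1)=0$ or $(V_2\otimes W_2)A(V_2\otimes W_2)=0$. Theorem (Description of weak irreducible SPC/PPT matrices). Let $A\in M_k\otimes M_m$ be an SPC or a PPT matrix. Then $A$ has a Hermitian Schmidt decomposition $A=\sum_{i=1}^n\lambda_i\,\gamma_i\otimes\delta_i$ with $\lambda_1\ge\dots\ge\lambda_n>0$, and for every such decomposition, $A$ is weak irreducible if and only if the following three conditions hold: 1. $\lambda_1>\lambda_i$ for all $2\le i\le n$; 2. $\operatorname{Im}(\gamma_i)\subseteq\operatorname{Im}(\gamma_1)$ for all $1\le i\le n$; 3. $\operatorname{Im}(\delta_i)\subseteq\operatorname{Im}(\delta_1)$ for all $1\le i\le n$. (If $A=0$, then $n=0$ and the three conditions hold vacuously.) -/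

import Mathlib

open scoped Kronecker ComplexOrder

/-! Matrices in `M_k ⊗ M_m` are matrices indexed by `Fin k × Fin m`; the elementary tensor of
`X` and `Y` is the Kronecker product `X ⊗ₖ Y`. -/

/-- Partial transposition on the first tensor factor, `X ⊗ Y ↦ Xᵗ ⊗ Y`. -/
def partialTranspose {k m : ℕ} (A : Matrix (Fin k × Fin m) (Fin k × Fin m) ℂ) :
    Matrix (Fin k × Fin m) (Fin k × Fin m) ℂ :=
  Matrix.of fun p q => A (q.1, p.2) (p.1, q.2)

theorem partialTranspose_kronecker {k m : ℕ} (X : Matrix (Fin k) (Fin k) ℂ)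
    (Y : Matrix (Fin m) (Fin m) ℂ) :
    partialTranspose (X ⊗ₖ Y) = X.transpose ⊗ₖ Y := by
  ext p q
  simp [partialTranspose, Matrix.kroneckerMap_apply]

/-- `A` is positive under partial transposition (PPT). -/
def IsPPT {k m : ℕ} (A : Matrix (Fin k × Fin m) (Fin k × Fin m) ℂ) : Prop :=
  A.PosSemidef ∧ (partialTranspose A).PosSemidef

/-- A finite family of complex matrices which is orthonormal for `⟨C, D⟩ = tr (C D^*)`. -/
def IsTraceOrthonormal {k n : ℕ} (γ : Fin n → Matrix (Fin k) (Fin k) ℂ) : Prop :=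
  ∀ i j, (γ i * (γ j).conjTranspose).trace = if i = j then 1 else 0

/-- `A = ∑ i, lam i • γ i ⊗ δ i` is a Hermitian Schmidt decomposition of `A`
(in no particular order). -/
structure IsHermitianSchmidt {k m n : ℕ} (A : Matrix (Fin k × Fin m) (Fin k × Fin m) ℂ)
    (lam : Fin n → ℝ) (γ : Fin n → Matrix (Fin k) (Fin k) ℂ)
    (δ : Fin n → Matrix (Fin m) (Fin m) ℂ) : Prop where
  pos : ∀ i, 0 < lam i
  hermitian_left : ∀ i, (γ i).IsHermitian
  hermitian_right : ∀ i, (δ i).IsHermitian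
  orthonormal_left : IsTraceOrthonormal γ
  orthonormal_right : IsTraceOrthonormal δ
  eq_sum : A = ∑ i, (lam i : ℂ) • (γ i ⊗ₖ δ i)

/-- `A ∈ M_k ⊗ M_k` is symmetric with positive coefficients (SPC). -/
def IsSPC {k : ℕ} (A : Matrix (Fin k × Fin k) (Fin k × Fin k) ℂ) : Prop :=
  A.PosSemidef ∧ ∃ (n : ℕ) (lam : Fin n → ℝ) (γ : Fin n → Matrix (Fin k) (Fin k) ℂ),
    IsHermitianSchmidt A lam γ γ

/-- A Hermitian (that is, orthogonal) projection. -/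
def IsHermitianProjection {k : ℕ} (V : Matrix (Fin k) (Fin k) ℂ) : Prop :=
  V.IsHermitian ∧ V * V = V

/-- `A` is weak irreducible. -/
def IsWeakIrreducible {k m : ℕ} (A : Matrix (Fin k × Fin m) (Fin k × Fin m) ℂ) : Prop :=
  A.PosSemidef ∧
  ∀ (V₁ V₂ : Matrix (Fin k) (Fin k) ℂ) (W₁ W₂ : Matrix (Fin m) (Fin m) ℂ),
    IsHermitianProjection V₁ → IsHermitianProjection V₂ →
    IsHermitianProjection W₁ → IsHermitianProjection W₂ →
    V₁ * V₂ = 0 → W₁ * W₂ = 0 → V₁ + V₂ = 1 → W₁ + W₂ = 1 →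
    A = (V₁ ⊗ₖ W₁) * A * (V₁ ⊗ₖ W₁) + (V₂ ⊗ₖ W₂) * A * (V₂ ⊗ₖ W₂) →
    (V₁ ⊗ₖ W₁) * A * (V₁ ⊗ₖ W₁) = 0 ∨ (V₂ ⊗ₖ W₂) * A * (V₂ ⊗ₖ W₂) = 0

/-- The image of a square complex matrix, as a subspace of `ℂ^k`. -/
def matrixImage {k : ℕ} (X : Matrix (Fin k) (Fin k) ℂ) : Submodule ℂ (Fin k → ℂ) :=
  LinearMap.range X.mulVecLin

/-- The three conditions on a Hermitian Schmidt decomposition. The first term is the one whose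
index `f` has value `0`; for the empty decomposition (of the zero matrix) nothing is required. -/
def DominatedByFirst {k m n : ℕ} (lam : Fin n → ℝ) (γ : Fin n → Matrix (Fin k) (Fin k) ℂ)
    (δ : Fin n → Matrix (Fin m) (Fin m) ℂ) : Prop :=
  ∀ f : Fin n, (f : ℕ) = 0 →
    (∀ i, i ≠ f → lam i < lam f) ∧
    (∀ i, matrixImage (γ i) ≤ matrixImage (γ f)) ∧
    (∀ i, matrixImage (δ i) ≤ matrixImage (δ f))

/-!
The matrix `A` is studied through the bilinear form `(X, Y) ↦ tr (A (X ⊗ Y))`. A Hermitian Schmidt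
decomposition is a singular value decomposition of this form on the real inner product spaces of
Hermitian matrices, so it exists as soon as `A` is Hermitian (`exists_isHermitianSchmidt`), and its
terms are singular pairs: `tr (A (γ i ⊗ Z)) = λ i tr (δ i Z)` and
`tr (A (Z ⊗ δ i)) = λ i tr (γ i Z)` for all `Z`. Write `V' = 1 - V` and `W' = 1 - W`.

The three conditions imply weak irreducibility for every positive semidefinite `A`
(`IsHermitianSchmidt.isWeakIrreducible`). If `A` is the sum of its corners at `V ⊗ W` and at
`V' ⊗ W'`, then `V ⊗ 1` and `1 ⊗ W` act on `A` in the same way from either side, so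
`(V γ₁, W δ₁)` is again a singular pair for `λ₁`. As `λ₁` is simple, `V γ₁ = c γ₁`, and `c` is `0`
or `1` because `V` is a projection. So `V` or `V'` annihilates `γ₁`, hence every `γ i`, whose image
is contained in that of `γ₁`, and the corresponding corner of `A` vanishes.

For the converse, let `λ i` be equal to the largest singular value. Positivity of `A` gives
`tr (A (|γ i| ⊗ |δ i|)) ≥ tr (A (γ i ⊗ δ i)) = λ i`, which is the maximum of the form on unit
vectors, so `(|γ i|, |δ i|)` is a singular pair too, and so are the pairs of positive parts and of
negative parts (`IsHermitianSchmidt.exists_isSingularPair_posSemidef`). Let `(X, Y)` be any nonzero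
singular pair of positive semidefinite matrices, with support projections `V` and `W`. Since
`tr (A (X ⊗ W')) = 0 = tr (A (V' ⊗ Y))`, also `A (V ⊗ W') = 0 = A (V' ⊗ W)`, and `A` is the sum of
its two corners provided that `(V ⊗ W) A (V' ⊗ W') = 0` (`IsCompletelyReducible`). Weak
irreducibility then leaves only the corner at `V ⊗ W`, so the image of `X` contains all images of
the `γ j`, and that of `Y` all images of the `δ j`
(`IsHermitianSchmidt.matrixImage_le_of_isSingularPair`). As the positive and the negative part of
`γ i` are orthogonal, one of them is zero: `γ i` is semidefinite, and its image contains all the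
others. Two orthogonal semidefinite matrices have product zero, so this happens for one `i` only.

Complete reducibility is where the two classes enter. For a PPT matrix the partial transpose of `A`
is positive semidefinite, and `tr (A (X ⊗ W')) = 0` gives `(V ⊗ 1) A (1 ⊗ W') = 0` as well
(`IsPPT.isCompletelyReducible`). For an SPC matrix the form is symmetric and positive semidefinite,
which forces `X = Y`, hence `V = W`, and then `A (V ⊗ V') = 0` gives
`∑ i, λ i • (B i)ᴴ ⊗ B i = 0` for `B i = V σ i V'`, so every `B i` is zero
(`IsSPC.isCompletelyReducible`).
-/

/-! ### Singular value decomposition -/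

/-- The singular value decomposition of a linear map between real inner product spaces, with the
positive singular values only: `u` consists of eigenvectors of `T† T`, and `v` of the normalized
images under `T`. -/
theorem LinearMap.exists_singular_value_decomposition {E F : Type*}
    [NormedAddCommGroup E] [InnerProductSpace ℝ E] [FiniteDimensional ℝ E]
    [NormedAddCommGroup F] [InnerProductSpace ℝ F] [FiniteDimensional ℝ F] (T : E →ₗ[ℝ] F) :
    ∃ (n : ℕ) (lam : Fin n → ℝ) (u : Fin n → E) (v : Fin n → F),
      (∀ i, 0 < lam i) ∧ Antitone lam ∧ Orthonormal ℝ u ∧ Orthonormal ℝ v ∧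
        ∀ x, T x = ∑ i, lam i • inner ℝ (u i) x • v i := by
  have hsym := T.isSymmetric_adjoint_comp_self
  let b := hsym.eigenvectorBasis rfl
  have hr : Module.finrank ℝ T.range ≤ Module.finrank ℝ E := T.finrank_range_le
  have hb : ∀ i j, inner ℝ (T (b i)) (T (b j)) = if i = j then T.singularValues j ^ 2 else 0 := by
    intro i j
    rw [← LinearMap.adjoint_inner_right, ← LinearMap.comp_apply, hsym.apply_eigenvectorBasis,
      inner_smul_right, T.sq_singularValues_fin rfl,
      orthonormal_iff_ite.mp b.orthonormal]
    split_ifs <;> simp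
  have hz : ∀ i : Fin (Module.finrank ℝ E), Module.finrank ℝ T.range ≤ i → T (b i) = 0 := by
    intro i hi
    have := hb i i
    rw [T.singularValues_eq_zero_iff_le_finrank_range.mpr hi] at this
    simpa using this
  have hpos : ∀ i : Fin (Module.finrank ℝ T.range), 0 < T.singularValues i := fun i ↦
    T.singularValues_pos_iff_lt_finrank_range.mpr i.2
  refine ⟨Module.finrank ℝ T.range, fun i ↦ T.singularValues i, fun i ↦ b (Fin.castLE hr i),
    fun i ↦ (T.singularValues i)⁻¹ • T (b (Fin.castLE hr i)), hpos,
    fun i j hij ↦ T.singularValues_antitone hij,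
    b.orthonormal.comp _ (Fin.castLE_injective hr), ?_, ?_⟩
  · rw [orthonormal_iff_ite]
    intro i j
    have := (hpos j).ne'
    rw [inner_smul_left, inner_smul_right, hb]
    by_cases h : i = j
    · subst h; simp; field_simp
    · simp [h]
  · intro x
    conv_lhs => rw [← b.sum_repr x, map_sum]
    simp only [map_smul, b.repr_apply_apply]
    -- Only the eigenvectors with nonzero image under `T` contribute.
    have himg : ∀ i ∈ Finset.univ, i ∉ Set.range (Fin.castLE hr) →
        inner ℝ (b i) x • T (b i) = 0 := by
      intro i _ hi
      rw [hz i, smul_zero]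
      by_contra! hlt
      exact hi ⟨⟨i, hlt⟩, rfl⟩
    rw [← Finset.sum_of_injOn (s := Finset.univ) (Fin.castLE hr) (Fin.castLE_injective hr).injOn
      (by simp) (by simpa only [Finset.coe_univ, Set.image_univ] using himg)
      (fun i _ ↦ rfl)]
    refine Finset.sum_congr rfl fun i _ ↦ ?_
    rw [smul_smul, smul_smul, mul_right_comm, mul_inv_cancel₀ (hpos i).ne', one_mul]

/-! ### The inner product space of Hermitian matrices -/

/-- The real vector space of Hermitian `k × k` matrices. It is a type of its own, so that it can
carry the norm of the trace inner product. -/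
def HermitianSpace (k : ℕ) : Type := selfAdjoint (Matrix (Fin k) (Fin k) ℂ)

namespace HermitianSpace

variable {k : ℕ}

instance : AddCommGroup (HermitianSpace k) :=
  inferInstanceAs (AddCommGroup (selfAdjoint (Matrix (Fin k) (Fin k) ℂ)))

noncomputable instance : Module ℝ (HermitianSpace k) :=
  inferInstanceAs (Module ℝ (selfAdjoint (Matrix (Fin k) (Fin k) ℂ)))

/-- The inclusion of the Hermitian matrices into all matrices. -/
noncomputable def toMatrix : HermitianSpace k →ₗ[ℝ] Matrix (Fin k) (Fin k) ℂ :=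
  (selfAdjoint.submodule ℝ (Matrix (Fin k) (Fin k) ℂ)).subtype

theorem toMatrix_injective : Function.Injective (toMatrix (k := k)) := Subtype.val_injective

theorem isHermitian (X : HermitianSpace k) : (toMatrix X).IsHermitian := X.2

instance : FiniteDimensional ℝ (HermitianSpace k) :=
  FiniteDimensional.of_injective toMatrix toMatrix_injective

end HermitianSpace

/-- The trace of a product of two Hermitian matrices is real. -/
theorem Matrix.IsHermitian.ofReal_re_trace_mul {ι : Type*} [Fintype ι] {X Y : Matrix ι ι ℂ}
    (hX : X.IsHermitian) (hY : Y.IsHermitian) : (((X * Y).trace.re : ℝ) : ℂ) = (X * Y).trace := by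
  rw [← Complex.conj_eq_iff_re, starRingEnd_apply, ← Matrix.trace_conjTranspose,
    Matrix.conjTranspose_mul, hX.eq, hY.eq, Matrix.trace_mul_comm]

theorem Matrix.IsHermitian.re_trace_mul_self_nonneg {ι : Type*} [Fintype ι] {X : Matrix ι ι ℂ}
    (hX : X.IsHermitian) : 0 ≤ (X * X).trace.re := by
  have := (Matrix.posSemidef_conjTranspose_mul_self X).trace_nonneg
  rw [hX.eq] at this
  exact (Complex.le_def.mp this).1

theorem Matrix.IsHermitian.eq_zero_of_re_trace_mul_self {ι : Type*} [Fintype ι]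
    {X : Matrix ι ι ℂ} (hX : X.IsHermitian) (h : (X * X).trace.re ≤ 0) : X = 0 := by
  rw [← Matrix.trace_conjTranspose_mul_self_eq_zero_iff, hX.eq, ← hX.ofReal_re_trace_mul hX,
    le_antisymm h hX.re_trace_mul_self_nonneg, Complex.ofReal_zero]

namespace HermitianSpace

variable {k : ℕ}

/-- The trace inner product `⟨X, Y⟩ = tr (X Y)` of Hermitian matrices. -/
@[reducible]
noncomputable def innerCore : InnerProductSpace.Core ℝ (HermitianSpace k) where
  inner X Y := (toMatrix X * toMatrix Y).trace.re
  conj_inner_symm X Y := by simp [Matrix.trace_mul_comm (toMatrix X)]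
  re_inner_nonneg X := X.isHermitian.re_trace_mul_self_nonneg
  add_left X Y Z := by simp [add_mul]
  smul_left X Y r := by simp
  definite X h := toMatrix_injective <|
    (X.isHermitian.eq_zero_of_re_trace_mul_self h.le).trans (map_zero _).symm

noncomputable instance : NormedAddCommGroup (HermitianSpace k) := innerCore.toNormedAddCommGroup

noncomputable instance : InnerProductSpace ℝ (HermitianSpace k) :=
  InnerProductSpace.ofCore innerCore.toCore

theorem ofReal_inner (X Y : HermitianSpace k) :
    ((inner ℝ X Y : ℝ) : ℂ) = (toMatrix X * toMatrix Y).trace :=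
  X.isHermitian.ofReal_re_trace_mul Y.isHermitian

theorem isTraceOrthonormal {n : ℕ} {u : Fin n → HermitianSpace k} (hu : Orthonormal ℝ u) :
    IsTraceOrthonormal fun i ↦ toMatrix (u i) := by
  intro i j
  rw [(isHermitian _).eq, ← ofReal_inner, orthonormal_iff_ite.mp hu]
  split_ifs <;> simp

end HermitianSpace

/-! ### Existence of a Hermitian Schmidt decomposition -/

/-- The linear map `X ↦ tr₁ (A (X ⊗ 1))`; for `A = C ⊗ D` it is `X ↦ tr (C X) D`. -/
def partialTraceLeft {k m : ℕ} (A : Matrix (Fin k × Fin m) (Fin k × Fin m) ℂ) :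
    Matrix (Fin k) (Fin k) ℂ →ₗ[ℂ] Matrix (Fin m) (Fin m) ℂ where
  toFun X := Matrix.of fun b d ↦ ∑ a, ∑ c, X c a * A (a, b) (c, d)
  map_add' X Y := by ext; simp [add_mul, Finset.sum_add_distrib]
  map_smul' r X := by ext; simp [Finset.mul_sum, mul_assoc]

theorem partialTraceLeft_isHermitian {k m : ℕ} {A : Matrix (Fin k × Fin m) (Fin k × Fin m) ℂ}
    (hA : A.IsHermitian) {X : Matrix (Fin k) (Fin k) ℂ} (hX : X.IsHermitian) :
    (partialTraceLeft A X).IsHermitian := by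
  ext b d
  simp only [partialTraceLeft, Matrix.conjTranspose_apply, LinearMap.coe_mk, AddHom.coe_mk,
    Matrix.of_apply, star_sum, star_mul', hX.apply, hA.apply]
  exact Finset.sum_comm

theorem partialTraceLeft_single {k m : ℕ} (A : Matrix (Fin k × Fin m) (Fin k × Fin m) ℂ)
    (a c : Fin k) (b d : Fin m) :
    partialTraceLeft A (Matrix.single c a 1) b d = A (a, b) (c, d) := by
  simp [partialTraceLeft, Matrix.single_apply, ite_and]

/-- Every Hermitian matrix has a Hermitian Schmidt decomposition: it is the singular value
decomposition of `X ↦ tr₁ (A (X ⊗ 1))` between the real spaces of Hermitian matrices. -/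
theorem exists_isHermitianSchmidt {k m : ℕ} {A : Matrix (Fin k × Fin m) (Fin k × Fin m) ℂ}
    (hA : A.IsHermitian) :
    ∃ (n : ℕ) (lam : Fin n → ℝ) (γ : Fin n → Matrix (Fin k) (Fin k) ℂ)
      (δ : Fin n → Matrix (Fin m) (Fin m) ℂ), IsHermitianSchmidt A lam γ δ ∧ Antitone lam := by
  let T : HermitianSpace k →ₗ[ℝ] HermitianSpace m :=
    { toFun X := ⟨partialTraceLeft A X.toMatrix, partialTraceLeft_isHermitian hA X.isHermitian⟩
      map_add' X Y := HermitianSpace.toMatrix_injective <| by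
        simp only [map_add]; rfl
      map_smul' r X := HermitianSpace.toMatrix_injective <| by
        simp only [map_smul]; exact ((partialTraceLeft A).restrictScalars ℝ).map_smul r _ }
  obtain ⟨n, lam, u, v, hpos, hanti, hu, hv, hT⟩ := T.exists_singular_value_decomposition
  refine ⟨n, lam, fun i ↦ (u i).toMatrix, fun i ↦ (v i).toMatrix,
    ⟨hpos, fun i ↦ (u i).isHermitian, fun i ↦ (v i).isHermitian,
      HermitianSpace.isTraceOrthonormal hu, HermitianSpace.isTraceOrthonormal hv, ?_⟩, hanti⟩
  have hherm : ∀ X : Matrix (Fin k) (Fin k) ℂ, X.IsHermitian → partialTraceLeft A X =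
      ∑ i, ((lam i : ℂ) * ((u i).toMatrix * X).trace) • (v i).toMatrix := by
    intro X hX
    let X' : HermitianSpace k := ⟨X, hX⟩
    have h := congrArg HermitianSpace.toMatrix (hT X')
    simp only [map_sum, map_smul, smul_smul] at h
    refine h.trans (Finset.sum_congr rfl fun i _ ↦ ?_)
    rw [← Complex.coe_smul, Complex.ofReal_mul, HermitianSpace.ofReal_inner]
    rfl
  -- Both sides are complex linear, so Hermitian `X` suffice; matrix units then give the entries.
  have hall : ∀ X : Matrix (Fin k) (Fin k) ℂ, partialTraceLeft A X =
      ∑ i, ((lam i : ℂ) * ((u i).toMatrix * X).trace) • (v i).toMatrix := by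
    intro X
    rw [← realPart_add_I_smul_imaginaryPart X, map_add, map_smul,
      hherm _ (realPart X).2, hherm _ (imaginaryPart X).2, Finset.smul_sum,
      ← Finset.sum_add_distrib]
    refine Finset.sum_congr rfl fun i _ ↦ ?_
    rw [smul_smul, ← add_smul, mul_add, Matrix.trace_add, Matrix.mul_smul, Matrix.trace_smul,
      smul_eq_mul, mul_add, mul_left_comm]
  ext ⟨a, b⟩ ⟨c, d⟩
  rw [← partialTraceLeft_single A a c b d, hall]
  simp [Matrix.sum_apply, Matrix.trace_mul_single, mul_assoc]

/-! ### Positive semidefinite matrices -/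

section PositiveSemidefinite

open scoped MatrixOrder

variable {ι : Type*} [Fintype ι] [DecidableEq ι]

theorem Matrix.PosSemidef.trace_mul_nonneg {A B : Matrix ι ι ℂ} (hA : A.PosSemidef)
    (hB : B.PosSemidef) : 0 ≤ (A * B).trace := by
  obtain ⟨C, rfl⟩ := CStarAlgebra.nonneg_iff_eq_star_mul_self.mp hB.nonneg
  rw [← mul_assoc, Matrix.trace_mul_comm, ← mul_assoc, Matrix.star_eq_conjTranspose]
  exact (hA.mul_mul_conjTranspose_same C).trace_nonneg

theorem Matrix.PosSemidef.mul_eq_zero_of_trace_mul_eq_zero {A B : Matrix ι ι ℂ}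
    (hA : A.PosSemidef) (hB : B.PosSemidef) (h : (A * B).trace = 0) : A * B = 0 := by
  obtain ⟨C, rfl⟩ := CStarAlgebra.nonneg_iff_eq_star_mul_self.mp hA.nonneg
  obtain ⟨D, rfl⟩ := CStarAlgebra.nonneg_iff_eq_star_mul_self.mp hB.nonneg
  simp only [Matrix.star_eq_conjTranspose] at h ⊢
  have h' : ((C * D.conjTranspose) * (C * D.conjTranspose).conjTranspose).trace = 0 := by
    rw [← h, Matrix.conjTranspose_mul, Matrix.conjTranspose_conjTranspose, ← mul_assoc,
      Matrix.trace_mul_comm]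
    simp only [mul_assoc]
  have h0 := Matrix.trace_mul_conjTranspose_self_eq_zero_iff.mp h'
  rw [mul_assoc, ← mul_assoc C, h0, zero_mul, mul_zero]

/-- The Jordan decomposition of a Hermitian matrix into its positive and its negative part. -/
theorem Matrix.IsHermitian.exists_posSemidef_sub_posSemidef {X : Matrix ι ι ℂ}
    (hX : X.IsHermitian) :
    ∃ P N : Matrix ι ι ℂ, P.PosSemidef ∧ N.PosSemidef ∧ X = P - N ∧ P * N = 0 ∧ N * P = 0 :=
  ⟨X⁺, X⁻, Matrix.nonneg_iff_posSemidef.mp (CFC.posPart_nonneg X),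
    Matrix.nonneg_iff_posSemidef.mp (CFC.negPart_nonneg X),
    (CFC.posPart_sub_negPart X hX).symm, CFC.posPart_mul_negPart X, CFC.negPart_mul_posPart X⟩

end PositiveSemidefinite

/-! ### Support projections and images -/

/-- `V` is the orthogonal projection onto the image of `X`. -/
structure IsSupportProjection {k : ℕ} (V X : Matrix (Fin k) (Fin k) ℂ) : Prop where
  isHermitianProjection : IsHermitianProjection V
  mul_eq : V * X = X
  exists_eq_mul : ∃ R, V = X * R

/-- In an eigenbasis of `X`, the support projection and its factor `R` are the diagonal matrices
with entries `d i * (d i)⁻¹` and `(d i)⁻¹`, where `0⁻¹ = 0` takes care of the kernel. -/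
theorem Matrix.IsHermitian.exists_isSupportProjection {k : ℕ} {X : Matrix (Fin k) (Fin k) ℂ}
    (hX : X.IsHermitian) : ∃ V, IsSupportProjection V X := by
  set φ := Unitary.conjStarAlgAut ℂ _ hX.eigenvectorUnitary
  set d : Fin k → ℂ := RCLike.ofReal ∘ hX.eigenvalues with hd
  have hφ : X = φ (Matrix.diagonal d) := hX.spectral_theorem
  have hinv : ∀ i, star (d i * (d i)⁻¹) = d i * (d i)⁻¹ := by intro i; simp [hd]
  refine ⟨φ (Matrix.diagonal fun i ↦ d i * (d i)⁻¹), ⟨?_, ?_⟩, ?_,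
    φ (Matrix.diagonal fun i ↦ (d i)⁻¹), ?_⟩
  · rw [Matrix.IsHermitian, ← Matrix.star_eq_conjTranspose, ← map_star,
      Matrix.star_eq_conjTranspose, Matrix.diagonal_conjTranspose]
    congr 2
    exact funext hinv
  · rw [← map_mul, Matrix.diagonal_mul_diagonal]
    congr 2
    ext i
    by_cases h : d i = 0 <;> simp [h]
  · rw [hφ, ← map_mul, Matrix.diagonal_mul_diagonal]
    congr 2
    ext i
    by_cases h : d i = 0 <;> simp [h]
  · rw [hφ, ← map_mul, Matrix.diagonal_mul_diagonal]

namespace IsHermitianProjection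

variable {k : ℕ} {V : Matrix (Fin k) (Fin k) ℂ}

theorem one_sub (hV : IsHermitianProjection V) : IsHermitianProjection (1 - V) :=
  ⟨Matrix.isHermitian_one.sub hV.1, by rw [mul_sub, sub_mul, sub_mul, hV.2]; simp⟩

theorem mul_one_sub (hV : IsHermitianProjection V) : V * (1 - V) = 0 := by
  rw [mul_sub, mul_one, hV.2, sub_self]

theorem one_sub_mul (hV : IsHermitianProjection V) : (1 - V) * V = 0 := by
  rw [sub_mul, one_mul, hV.2, sub_self]

theorem posSemidef (hV : IsHermitianProjection V) : V.PosSemidef := by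
  have := Matrix.posSemidef_conjTranspose_mul_self V
  rwa [hV.1.eq, hV.2] at this

end IsHermitianProjection

namespace IsSupportProjection

variable {k : ℕ} {V W X : Matrix (Fin k) (Fin k) ℂ}

theorem mul_eq_right (hV : IsSupportProjection V X) (hX : X.IsHermitian) : X * V = X := by
  have := congrArg Matrix.conjTranspose hV.mul_eq
  rwa [Matrix.conjTranspose_mul, hX.eq, hV.isHermitianProjection.1.eq] at this

theorem exists_eq_mul_right (hV : IsSupportProjection V X) (hX : X.IsHermitian) :
    ∃ R, V = R * X := by
  obtain ⟨R, hR⟩ := hV.exists_eq_mul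
  refine ⟨R.conjTranspose, ?_⟩
  have := congrArg Matrix.conjTranspose hR
  rwa [Matrix.conjTranspose_mul, hX.eq, hV.isHermitianProjection.1.eq] at this

theorem unique (hV : IsSupportProjection V X) (hW : IsSupportProjection W X) : V = W := by
  obtain ⟨R, hR⟩ := hV.exists_eq_mul
  obtain ⟨S, hS⟩ := hW.exists_eq_mul
  have h1 : V * W = W := by rw [hS, ← mul_assoc, hV.mul_eq]
  have h2 : W * V = V := by rw [hR, ← mul_assoc, hW.mul_eq]
  have h3 := congrArg Matrix.conjTranspose h1
  rw [Matrix.conjTranspose_mul, hV.isHermitianProjection.1.eq,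
    hW.isHermitianProjection.1.eq, h2] at h3
  exact h3

end IsSupportProjection

section Image

variable {k : ℕ} {X Y : Matrix (Fin k) (Fin k) ℂ}

theorem matrixImage_mul_le (X Y : Matrix (Fin k) (Fin k) ℂ) :
    matrixImage (X * Y) ≤ matrixImage X := by
  rw [matrixImage, Matrix.mulVecLin_mul]
  exact LinearMap.range_comp_le_range _ _

theorem matrixImage_neg (X : Matrix (Fin k) (Fin k) ℂ) : matrixImage (-X) = matrixImage X :=
  le_antisymm (by simpa using matrixImage_mul_le X (-1)) (by simpa using matrixImage_mul_le (-X) (-1))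

theorem mul_eq_zero_of_matrixImage_le (h : matrixImage X ≤ matrixImage Y)
    {B : Matrix (Fin k) (Fin k) ℂ} (hB : B * Y = 0) : B * X = 0 := by
  refine Matrix.ext_of_mulVec_single fun j ↦ ?_
  obtain ⟨v, hv⟩ := h ⟨Pi.single j 1, rfl⟩
  rw [Matrix.mulVecLin_apply, Matrix.mulVecLin_apply] at hv
  rw [← Matrix.mulVec_mulVec, ← hv, Matrix.mulVec_mulVec, hB, Matrix.zero_mulVec, Matrix.zero_mulVec]

end Image

/-! ### Singular pairs -/

theorem Matrix.eq_zero_of_forall_trace_mul {ι : Type*} [Fintype ι] {X : Matrix ι ι ℂ}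
    (h : ∀ Z : Matrix ι ι ℂ, (X * Z).trace = 0) : X = 0 :=
  Matrix.trace_mul_conjTranspose_self_eq_zero_iff.mp (h _)

theorem Matrix.eq_of_forall_trace_mul {ι : Type*} [Fintype ι] {X Y : Matrix ι ι ℂ}
    (h : ∀ Z : Matrix ι ι ℂ, (X * Z).trace = (Y * Z).trace) : X = Y :=
  sub_eq_zero.mp <| Matrix.eq_zero_of_forall_trace_mul fun Z ↦ by
    rw [sub_mul, Matrix.trace_sub, h, sub_self]

/-- `(X, Y)` is a pair of singular vectors, with singular value `μ`, of the bilinear form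
`(X, Y) ↦ tr (A (X ⊗ Y))`. -/
structure IsSingularPair {k m : ℕ} (A : Matrix (Fin k × Fin m) (Fin k × Fin m) ℂ) (μ : ℝ)
    (X : Matrix (Fin k) (Fin k) ℂ) (Y : Matrix (Fin m) (Fin m) ℂ) : Prop where
  trace_left : ∀ Z, (A * (X ⊗ₖ Z)).trace = (μ : ℂ) * (Y * Z).trace
  trace_right : ∀ Z, (A * (Z ⊗ₖ Y)).trace = (μ : ℂ) * (X * Z).trace

namespace IsSingularPair

variable {k m : ℕ} {A : Matrix (Fin k × Fin m) (Fin k × Fin m) ℂ} {μ : ℝ}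
  {X X' : Matrix (Fin k) (Fin k) ℂ} {Y Y' : Matrix (Fin m) (Fin m) ℂ}

theorem add (h : IsSingularPair A μ X Y) (h' : IsSingularPair A μ X' Y') :
    IsSingularPair A μ (X + X') (Y + Y') where
  trace_left Z := by
    rw [Matrix.add_kronecker, mul_add, Matrix.trace_add, h.trace_left, h'.trace_left, add_mul,
      Matrix.trace_add, mul_add]
  trace_right Z := by
    rw [Matrix.kronecker_add, mul_add, Matrix.trace_add, h.trace_right, h'.trace_right, add_mul,
      Matrix.trace_add, mul_add]

theorem smul (h : IsSingularPair A μ X Y) (c : ℂ) : IsSingularPair A μ (c • X) (c • Y) where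
  trace_left Z := by
    rw [Matrix.smul_kronecker, Matrix.mul_smul, Matrix.trace_smul, h.trace_left, Matrix.smul_mul,
      Matrix.trace_smul, smul_eq_mul, smul_eq_mul, mul_left_comm]
  trace_right Z := by
    rw [Matrix.kronecker_smul, Matrix.mul_smul, Matrix.trace_smul, h.trace_right, Matrix.smul_mul,
      Matrix.trace_smul, smul_eq_mul, smul_eq_mul, mul_left_comm]

theorem right_eq_zero (h : IsSingularPair A μ 0 Y) (hμ : 0 < μ) : Y = 0 :=
  Matrix.eq_zero_of_forall_trace_mul fun Z ↦ by
    have := h.trace_left Z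
    simpa [hμ.ne'] using this

theorem mul_kronecker_one_sub_eq_zero (h : IsSingularPair A μ X Y) (hA : A.PosSemidef)
    (hX : X.PosSemidef) (hY : Y.PosSemidef) {V : Matrix (Fin k) (Fin k) ℂ}
    {W : Matrix (Fin m) (Fin m) ℂ} (hV : IsSupportProjection V X) (hW : IsSupportProjection W Y) :
    A * (V ⊗ₖ (1 - W)) = 0 := by
  have h0 : A * (X ⊗ₖ (1 - W)) = 0 := by
    refine hA.mul_eq_zero_of_trace_mul_eq_zero
      (hX.kronecker hW.isHermitianProjection.one_sub.posSemidef) ?_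
    rw [h.trace_left, mul_sub, hW.mul_eq_right hY.1, mul_one, sub_self, Matrix.trace_zero, mul_zero]
  obtain ⟨R, hR⟩ := hV.exists_eq_mul
  rw [hR, ← mul_one (1 - W), Matrix.mul_kronecker_mul, ← mul_assoc, h0, zero_mul]

theorem mul_one_sub_kronecker_eq_zero (h : IsSingularPair A μ X Y) (hA : A.PosSemidef)
    (hX : X.PosSemidef) (hY : Y.PosSemidef) {V : Matrix (Fin k) (Fin k) ℂ}
    {W : Matrix (Fin m) (Fin m) ℂ} (hV : IsSupportProjection V X) (hW : IsSupportProjection W Y) :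
    A * ((1 - V) ⊗ₖ W) = 0 := by
  have h0 : A * ((1 - V) ⊗ₖ Y) = 0 := by
    refine hA.mul_eq_zero_of_trace_mul_eq_zero
      (hV.isHermitianProjection.one_sub.posSemidef.kronecker hY) ?_
    rw [h.trace_right, mul_sub, hV.mul_eq_right hX.1, mul_one, sub_self, Matrix.trace_zero,
      mul_zero]
  obtain ⟨R, hR⟩ := hW.exists_eq_mul
  rw [hR, ← mul_one (1 - V), Matrix.mul_kronecker_mul, ← mul_assoc, h0, zero_mul]

end IsSingularPair

namespace IsHermitianSchmidt

variable {k m n : ℕ} {A : Matrix (Fin k × Fin m) (Fin k × Fin m) ℂ} {lam : Fin n → ℝ}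
  {γ : Fin n → Matrix (Fin k) (Fin k) ℂ} {δ : Fin n → Matrix (Fin m) (Fin m) ℂ}

theorem trace_mul_kronecker (h : IsHermitianSchmidt A lam γ δ) (X : Matrix (Fin k) (Fin k) ℂ)
    (Y : Matrix (Fin m) (Fin m) ℂ) :
    (A * (X ⊗ₖ Y)).trace = ∑ i, (lam i : ℂ) * ((γ i * X).trace * (δ i * Y).trace) := by
  rw [h.eq_sum, Finset.sum_mul, Matrix.trace_sum]
  refine Finset.sum_congr rfl fun i _ ↦ ?_
  rw [Matrix.smul_mul, ← Matrix.mul_kronecker_mul, Matrix.trace_smul, Matrix.trace_kronecker,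
    smul_eq_mul]

theorem trace_left_mul (h : IsHermitianSchmidt A lam γ δ) (i j : Fin n) :
    (γ i * γ j).trace = if i = j then 1 else 0 := by
  rw [← h.orthonormal_left i j, (h.hermitian_left j).eq]

theorem trace_right_mul (h : IsHermitianSchmidt A lam γ δ) (i j : Fin n) :
    (δ i * δ j).trace = if i = j then 1 else 0 := by
  rw [← h.orthonormal_right i j, (h.hermitian_right j).eq]

theorem left_ne_zero (h : IsHermitianSchmidt A lam γ δ) (i : Fin n) : γ i ≠ 0 := fun h0 ↦ by
  simpa [h0] using h.trace_left_mul i i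

theorem isSingularPair (h : IsHermitianSchmidt A lam γ δ) (i : Fin n) :
    IsSingularPair A (lam i) (γ i) (δ i) where
  trace_left Z := by simp [h.trace_mul_kronecker, h.trace_left_mul]
  trace_right Z := by simp [h.trace_mul_kronecker, h.trace_right_mul]

/-- `B ⊗ 1` annihilates `A` only if `B` annihilates every left Schmidt vector: pair
`(B ⊗ 1) A` with the matrices `Z ⊗ δ i`. -/
theorem mul_left_eq_zero (h : IsHermitianSchmidt A lam γ δ) {B : Matrix (Fin k) (Fin k) ℂ}
    (hB : (B ⊗ₖ (1 : Matrix (Fin m) (Fin m) ℂ)) * A = 0) (i : Fin n) : B * γ i = 0 := by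
  refine Matrix.eq_zero_of_forall_trace_mul fun Z ↦ ?_
  have h1 := (h.isSingularPair i).trace_right (Z * B)
  have h2 : (A * ((Z * B) ⊗ₖ δ i)).trace = 0 := by
    rw [← mul_one (δ i), Matrix.mul_kronecker_mul, ← mul_assoc, Matrix.trace_mul_comm, ← mul_assoc,
      hB, zero_mul, Matrix.trace_zero]
  rw [h2, ← mul_assoc, Matrix.trace_mul_comm, ← mul_assoc, eq_comm, mul_eq_zero] at h1
  exact h1.resolve_left (by exact_mod_cast (h.pos i).ne')

theorem mul_right_eq_zero (h : IsHermitianSchmidt A lam γ δ) {B : Matrix (Fin m) (Fin m) ℂ}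
    (hB : ((1 : Matrix (Fin k) (Fin k) ℂ) ⊗ₖ B) * A = 0) (i : Fin n) : B * δ i = 0 := by
  refine Matrix.eq_zero_of_forall_trace_mul fun Z ↦ ?_
  have h1 := (h.isSingularPair i).trace_left (Z * B)
  have h2 : (A * (γ i ⊗ₖ (Z * B))).trace = 0 := by
    rw [← mul_one (γ i), Matrix.mul_kronecker_mul, ← mul_assoc, Matrix.trace_mul_comm, ← mul_assoc,
      hB, zero_mul, Matrix.trace_zero]
  rw [h2, ← mul_assoc, Matrix.trace_mul_comm, ← mul_assoc, eq_comm, mul_eq_zero] at h1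
  exact h1.resolve_left (by exact_mod_cast (h.pos i).ne')

theorem kronecker_one_mul_eq_zero (h : IsHermitianSchmidt A lam γ δ)
    {B : Matrix (Fin k) (Fin k) ℂ} (hB : ∀ i, B * γ i = 0) :
    (B ⊗ₖ (1 : Matrix (Fin m) (Fin m) ℂ)) * A = 0 := by
  rw [h.eq_sum, Finset.mul_sum]
  refine Finset.sum_eq_zero fun i _ ↦ ?_
  rw [Matrix.mul_smul, ← Matrix.mul_kronecker_mul, hB, Matrix.zero_kronecker, smul_zero]

/-- A simple singular value has, up to a scalar, only one singular vector. -/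
theorem exists_eq_smul (h : IsHermitianSchmidt A lam γ δ) {f : Fin n}
    (hf : ∀ i, i ≠ f → lam i ≠ lam f) {X : Matrix (Fin k) (Fin k) ℂ}
    {Y : Matrix (Fin m) (Fin m) ℂ} (hXY : IsSingularPair A (lam f) X Y) :
    ∃ c : ℂ, X = c • γ f := by
  have hf0 : (lam f : ℂ) ≠ 0 := by exact_mod_cast (h.pos f).ne'
  have hy : ∀ i, i ≠ f → (δ i * Y).trace = 0 := by
    intro i hi
    have h1 := hXY.trace_left (δ i)
    have h2 := hXY.trace_right (γ i)
    rw [(h.isSingularPair i).trace_right, Matrix.trace_mul_comm Y] at h1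
    rw [(h.isSingularPair i).trace_left, Matrix.trace_mul_comm X] at h2
    have h3 : ((lam f : ℂ) ^ 2 - lam i ^ 2) * (δ i * Y).trace = 0 := by
      linear_combination (-(lam f : ℂ)) * h1 - lam i * h2
    refine (mul_eq_zero.mp h3).resolve_left fun h4 ↦ hf i hi ?_
    have h5 : lam f ^ 2 = lam i ^ 2 := by exact_mod_cast sub_eq_zero.mp h4
    exact ((sq_eq_sq₀ (h.pos f).le (h.pos i).le).mp h5).symm
  refine ⟨(δ f * Y).trace, Matrix.eq_of_forall_trace_mul fun Z ↦ mul_left_cancel₀ hf0 ?_⟩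
  rw [← hXY.trace_right, h.trace_mul_kronecker, Finset.sum_eq_single f]
  · rw [Matrix.smul_mul, Matrix.trace_smul, smul_eq_mul, mul_comm (Matrix.trace _)]
  · intro i _ hi
    rw [hy i hi, mul_zero, mul_zero]
  · simp

end IsHermitianSchmidt

/-! ### The largest singular value -/

/-- Unit vectors `x`, `y` at which the bilinear form with singular system `(lam, u, v)` attains its
largest singular value `L` are singular vectors. -/
theorem Orthonormal.sum_smul_eq_of_le_sum {E F : Type*} [NormedAddCommGroup E]
    [InnerProductSpace ℝ E] [NormedAddCommGroup F] [InnerProductSpace ℝ F] {n : ℕ}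
    {u : Fin n → E} {v : Fin n → F} (hu : Orthonormal ℝ u) (hv : Orthonormal ℝ v)
    {lam : Fin n → ℝ} {L : ℝ} (h0 : ∀ i, 0 ≤ lam i) (hL : ∀ i, lam i ≤ L) (hL0 : 0 ≤ L)
    {x : E} {y : F} (hx : ‖x‖ = 1) (hy : ‖y‖ = 1)
    (h : L ≤ ∑ i, lam i * (inner ℝ (u i) x * inner ℝ (v i) y)) :
    ∑ i, (lam i * inner ℝ (u i) x) • v i = L • y := by
  rw [← sub_eq_zero, ← norm_eq_zero, ← sq_eq_zero_iff]
  refine le_antisymm ?_ (sq_nonneg _)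
  set z := ∑ i, (lam i * inner ℝ (u i) x) • v i with hz
  have h1 : ‖z‖ ^ 2 ≤ L ^ 2 := by
    have hb := hu.sum_inner_products_le (s := Finset.univ) x
    rw [hx] at hb
    rw [← real_inner_self_eq_norm_sq, hz, hv.inner_sum]
    calc ∑ i, (starRingEnd ℝ) (lam i * inner ℝ (u i) x) * (lam i * inner ℝ (u i) x)
        ≤ ∑ i, L ^ 2 * ‖inner ℝ (u i) x‖ ^ 2 := Finset.sum_le_sum fun i _ ↦ by
          rw [Real.norm_eq_abs, sq_abs, conj_trivial, ← sq, mul_pow]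
          exact mul_le_mul_of_nonneg_right (pow_le_pow_left₀ (h0 i) (hL i) 2) (sq_nonneg _)
      _ ≤ L ^ 2 := by
          rw [← Finset.mul_sum]
          exact mul_le_of_le_one_right (sq_nonneg L) (by simpa using hb)
  have h2 : L ≤ inner ℝ z y := by
    rw [hz, sum_inner]
    refine h.trans_eq (Finset.sum_congr rfl fun i _ ↦ ?_)
    rw [real_inner_smul_left, mul_assoc]
  rw [norm_sub_sq_real, inner_smul_right, norm_smul, hy, mul_one, Real.norm_eq_abs, sq_abs]
  nlinarith

theorem Matrix.sub_kronecker {ι κ : Type*} (X Y : Matrix ι ι ℂ) (Z : Matrix κ κ ℂ) :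
    (X - Y) ⊗ₖ Z = X ⊗ₖ Z - Y ⊗ₖ Z := by
  ext
  simp [sub_mul]

theorem Matrix.kronecker_sub {ι κ : Type*} (X : Matrix ι ι ℂ) (Y Z : Matrix κ κ ℂ) :
    X ⊗ₖ (Y - Z) = X ⊗ₖ Y - X ⊗ₖ Z := by
  ext
  simp [mul_sub]

theorem HermitianSpace.orthonormal {k n : ℕ} {u : Fin n → HermitianSpace k}
    (hu : IsTraceOrthonormal fun i ↦ (u i).toMatrix) : Orthonormal ℝ u := by
  rw [orthonormal_iff_ite]
  intro i j
  have := hu i j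
  rw [(isHermitian _).eq, ← ofReal_inner] at this
  split_ifs at this ⊢ <;> exact_mod_cast this

namespace IsHermitianSchmidt

variable {k m n : ℕ} {A : Matrix (Fin k × Fin m) (Fin k × Fin m) ℂ} {lam : Fin n → ℝ}
  {γ : Fin n → Matrix (Fin k) (Fin k) ℂ} {δ : Fin n → Matrix (Fin m) (Fin m) ℂ}

/-- A variational characterization of the singular pairs for the largest singular value. -/
theorem isSingularPair_of_le_trace (h : IsHermitianSchmidt A lam γ δ) {L : ℝ}
    (hL : ∀ i, lam i ≤ L) (hL0 : 0 ≤ L) {X : Matrix (Fin k) (Fin k) ℂ}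
    {Y : Matrix (Fin m) (Fin m) ℂ} (hX : X.IsHermitian) (hY : Y.IsHermitian)
    (hX1 : (X * X).trace = 1) (hY1 : (Y * Y).trace = 1)
    (hXY : L ≤ (A * (X ⊗ₖ Y)).trace.re) : IsSingularPair A L X Y := by
  let u : Fin n → HermitianSpace k := fun i ↦ ⟨γ i, h.hermitian_left i⟩
  let v : Fin n → HermitianSpace m := fun i ↦ ⟨δ i, h.hermitian_right i⟩
  let x : HermitianSpace k := ⟨X, hX⟩
  let y : HermitianSpace m := ⟨Y, hY⟩
  have hu : Orthonormal ℝ u := HermitianSpace.orthonormal h.orthonormal_left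
  have hv : Orthonormal ℝ v := HermitianSpace.orthonormal h.orthonormal_right
  have hux : ∀ i, ((inner ℝ (u i) x : ℝ) : ℂ) = (γ i * X).trace := fun i ↦
    HermitianSpace.ofReal_inner _ _
  have hvy : ∀ i, ((inner ℝ (v i) y : ℝ) : ℂ) = (δ i * Y).trace := fun i ↦
    HermitianSpace.ofReal_inner _ _
  have hx : ‖x‖ = 1 := by
    have : inner ℝ x x = (1 : ℝ) := by
      exact_mod_cast (HermitianSpace.ofReal_inner x x).trans hX1
    rw [norm_eq_sqrt_real_inner, this, Real.sqrt_one]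
  have hy : ‖y‖ = 1 := by
    have : inner ℝ y y = (1 : ℝ) := by
      exact_mod_cast (HermitianSpace.ofReal_inner y y).trans hY1
    rw [norm_eq_sqrt_real_inner, this, Real.sqrt_one]
  have hsum : (A * (X ⊗ₖ Y)).trace.re = ∑ i, lam i * (inner ℝ (u i) x * inner ℝ (v i) y) := by
    rw [← Complex.ofReal_re (∑ i, _), h.trace_mul_kronecker]
    push_cast
    simp only [hux, hvy]
  rw [hsum] at hXY
  have h1 := congrArg HermitianSpace.toMatrix
    (hu.sum_smul_eq_of_le_sum hv (fun i ↦ (h.pos i).le) hL hL0 hx hy hXY)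
  have h2 := congrArg HermitianSpace.toMatrix
    (hv.sum_smul_eq_of_le_sum hu (fun i ↦ (h.pos i).le) hL hL0 hy hx
      (by simpa only [mul_comm (inner ℝ (v _) y)] using hXY))
  simp only [map_sum, map_smul, ← Complex.coe_smul, Complex.ofReal_mul, hux, hvy] at h1 h2
  change ∑ i, ((lam i : ℂ) * (γ i * X).trace) • δ i = (L : ℂ) • Y at h1
  change ∑ i, ((lam i : ℂ) * (δ i * Y).trace) • γ i = (L : ℂ) • X at h2
  constructor <;> intro Z
  · rw [← smul_eq_mul (L : ℂ), ← Matrix.trace_smul, ← Matrix.smul_mul, ← h1, Finset.sum_mul,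
      Matrix.trace_sum, h.trace_mul_kronecker]
    simp only [Matrix.smul_mul, Matrix.trace_smul, smul_eq_mul, mul_assoc]
  · rw [← smul_eq_mul (L : ℂ), ← Matrix.trace_smul, ← Matrix.smul_mul, ← h2, Finset.sum_mul,
      Matrix.trace_sum, h.trace_mul_kronecker]
    simp only [Matrix.smul_mul, Matrix.trace_smul, smul_eq_mul, mul_assoc,
      mul_comm (Matrix.trace (γ _ * Z))]

/-- A Perron–Frobenius argument: the positive parts and the negative parts of the singular vectors
for the largest singular value are themselves singular vectors, because
`(|γ i|, |δ i|)` attains the maximum as well. -/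
theorem exists_isSingularPair_posSemidef (h : IsHermitianSchmidt A lam γ δ) (hA : A.PosSemidef)
    {i : Fin n} (hi : ∀ j, lam j ≤ lam i) :
    ∃ P N P' N', P.PosSemidef ∧ N.PosSemidef ∧ P'.PosSemidef ∧ N'.PosSemidef ∧
      γ i = P - N ∧ δ i = P' - N' ∧ P * N = 0 ∧ N * P = 0 ∧
      IsSingularPair A (lam i) P P' ∧ IsSingularPair A (lam i) N N' := by
  obtain ⟨P, N, hP, hN, hγ, hPN, hNP⟩ := (h.hermitian_left i).exists_posSemidef_sub_posSemidef
  obtain ⟨P', N', hP', hN', hδ, hPN', hNP'⟩ :=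
    (h.hermitian_right i).exists_posSemidef_sub_posSemidef
  have hpair : IsSingularPair A (lam i) (P - N) (P' - N') := hγ ▸ hδ ▸ h.isSingularPair i
  have hγ1 := h.trace_left_mul i i
  have hδ1 := h.trace_right_mul i i
  have hsum : IsSingularPair A (lam i) (P + N) (P' + N') := by
    refine h.isSingularPair_of_le_trace hi (h.pos i).le (hP.add hN).1 (hP'.add hN').1 ?_ ?_ ?_
    · rw [hγ] at hγ1
      simpa [mul_add, add_mul, mul_sub, sub_mul, hPN, hNP] using hγ1
    · rw [hδ] at hδ1
      simpa [mul_add, add_mul, mul_sub, sub_mul, hPN', hNP'] using hδ1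
    · have h1 : (A * ((P - N) ⊗ₖ (P' - N'))).trace = lam i := by
        rw [← hγ, ← hδ, (h.isSingularPair i).trace_left, hδ1, if_pos rfl, mul_one]
      have h2 : (A * ((P + N) ⊗ₖ (P' + N'))).trace =
          (A * ((P - N) ⊗ₖ (P' - N'))).trace +
            2 * ((A * (P ⊗ₖ N')).trace + (A * (N ⊗ₖ P')).trace) := by
        simp only [Matrix.add_kronecker, Matrix.kronecker_add, Matrix.sub_kronecker,
          Matrix.kronecker_sub, mul_add, mul_sub, Matrix.trace_add, Matrix.trace_sub]
        ring
      have h3 := (Complex.le_def.mp (hA.trace_mul_nonneg (hP.kronecker hN'))).1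
      have h4 := (Complex.le_def.mp (hA.trace_mul_nonneg (hN.kronecker hP'))).1
      rw [h2, h1]
      simp only [Complex.add_re, Complex.mul_re, Complex.ofReal_re, Complex.re_ofNat,
        Complex.im_ofNat, Complex.zero_re] at h3 h4 ⊢
      linarith
  refine ⟨P, N, P', N', hP, hN, hP', hN', hγ, hδ, hPN, hNP, ?_, ?_⟩
  · convert (hsum.add hpair).smul (1 / 2) using 1 <;> module
  · convert (hsum.add (hpair.smul (-1))).smul (1 / 2) using 1 <;> module

end IsHermitianSchmidt

/-! ### Weak irreducibility -/

/-- The complete reducibility property used in the theorem: the corner of `A` between the supports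
of a pair of positive semidefinite singular vectors and the complementary supports vanishes. -/
def IsCompletelyReducible {k m : ℕ} (A : Matrix (Fin k × Fin m) (Fin k × Fin m) ℂ) : Prop :=
  ∀ (μ : ℝ) (X V : Matrix (Fin k) (Fin k) ℂ) (Y W : Matrix (Fin m) (Fin m) ℂ), 0 < μ →
    X.PosSemidef → Y.PosSemidef → IsSingularPair A μ X Y →
    IsSupportProjection V X → IsSupportProjection W Y →
    (V ⊗ₖ W) * A * ((1 - V) ⊗ₖ (1 - W)) = 0

theorem one_eq_sum_kronecker {k m : ℕ} (V : Matrix (Fin k) (Fin k) ℂ)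
    (W : Matrix (Fin m) (Fin m) ℂ) :
    (1 : Matrix (Fin k × Fin m) (Fin k × Fin m) ℂ) =
      V ⊗ₖ W + (1 - V) ⊗ₖ (1 - W) + (V ⊗ₖ (1 - W) + (1 - V) ⊗ₖ W) := by
  rw [← Matrix.one_kronecker_one]
  simp only [Matrix.sub_kronecker, Matrix.kronecker_sub]
  abel

theorem eq_sum_corners {k m : ℕ} {A : Matrix (Fin k × Fin m) (Fin k × Fin m) ℂ}
    (hA : A.IsHermitian) {V : Matrix (Fin k) (Fin k) ℂ} {W : Matrix (Fin m) (Fin m) ℂ}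
    (hV : V.IsHermitian) (hW : W.IsHermitian) (h1 : A * (V ⊗ₖ (1 - W)) = 0)
    (h2 : A * ((1 - V) ⊗ₖ W) = 0) (h3 : (V ⊗ₖ W) * A * ((1 - V) ⊗ₖ (1 - W)) = 0) :
    A = (V ⊗ₖ W) * A * (V ⊗ₖ W) + ((1 - V) ⊗ₖ (1 - W)) * A * ((1 - V) ⊗ₖ (1 - W)) := by
  have hV' : (1 - V).IsHermitian := Matrix.isHermitian_one.sub hV
  have hW' : (1 - W).IsHermitian := Matrix.isHermitian_one.sub hW
  have h4 : ((1 - V) ⊗ₖ (1 - W)) * A * (V ⊗ₖ W) = 0 := by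
    have := congrArg Matrix.conjTranspose h3
    simpa only [Matrix.conjTranspose_mul, Matrix.conjTranspose_kronecker, hA.eq, hV.eq, hW.eq,
      hV'.eq, hW'.eq, Matrix.conjTranspose_zero, ← mul_assoc] using this
  have h5 : (V ⊗ₖ (1 - W)) * A = 0 := by
    have := congrArg Matrix.conjTranspose h1
    simpa only [Matrix.conjTranspose_mul, Matrix.conjTranspose_kronecker, hA.eq, hV.eq, hW'.eq,
      Matrix.conjTranspose_zero] using this
  have h6 : ((1 - V) ⊗ₖ W) * A = 0 := by
    have := congrArg Matrix.conjTranspose h2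
    simpa only [Matrix.conjTranspose_mul, Matrix.conjTranspose_kronecker, hA.eq, hV'.eq, hW.eq,
      Matrix.conjTranspose_zero] using this
  conv_lhs => rw [← one_mul A, ← mul_one (1 * A), one_eq_sum_kronecker V W]
  rw [add_mul _ _ A, add_mul _ _ A, add_mul _ _ A, h5, h6, add_zero, add_zero]
  simp only [mul_add, add_mul, mul_assoc, h1, h2, mul_zero, add_zero] at h3 h4 ⊢
  rw [h3, h4, add_zero, zero_add]

namespace IsHermitianSchmidt

variable {k m n : ℕ} {A : Matrix (Fin k × Fin m) (Fin k × Fin m) ℂ} {lam : Fin n → ℝ}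
  {γ : Fin n → Matrix (Fin k) (Fin k) ℂ} {δ : Fin n → Matrix (Fin m) (Fin m) ℂ}

/-- The images of a nonzero pair of positive semidefinite singular vectors of a weakly irreducible
matrix contain the images of all Schmidt vectors. -/
theorem matrixImage_le_of_isSingularPair (h : IsHermitianSchmidt A lam γ δ)
    (hA : IsWeakIrreducible A) (hred : IsCompletelyReducible A) {μ : ℝ} (hμ : 0 < μ)
    {X : Matrix (Fin k) (Fin k) ℂ} {Y : Matrix (Fin m) (Fin m) ℂ} (hX : X.PosSemidef)
    (hY : Y.PosSemidef) (hX0 : X ≠ 0) (hXY : IsSingularPair A μ X Y) (i : Fin n) :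
    matrixImage (γ i) ≤ matrixImage X ∧ matrixImage (δ i) ≤ matrixImage Y := by
  obtain ⟨V, hV⟩ := hX.1.exists_isSupportProjection
  obtain ⟨W, hW⟩ := hY.1.exists_isSupportProjection
  have hVp := hV.isHermitianProjection
  have hWp := hW.isHermitianProjection
  have hsum := eq_sum_corners hA.1.1 hVp.1 hWp.1
    (hXY.mul_kronecker_one_sub_eq_zero hA.1 hX hY hV hW)
    (hXY.mul_one_sub_kronecker_eq_zero hA.1 hX hY hV hW) (hred μ X V Y W hμ hX hY hXY hV hW)
  have hcorner : ((1 - V) ⊗ₖ (1 - W)) * A * ((1 - V) ⊗ₖ (1 - W)) = 0 := by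
    refine (hA.2 V (1 - V) W (1 - W) hVp hVp.one_sub hWp hWp.one_sub hVp.mul_one_sub
      hWp.mul_one_sub (add_sub_cancel _ _) (add_sub_cancel _ _) hsum).resolve_left fun h0 ↦ hX0 ?_
    -- The corner at the supports of `X` and `Y` pairs with `X ⊗ Y` to `μ * tr (X ^ 2)`.
    have h1 := hXY.trace_right X
    rw [hsum, h0, zero_add, mul_assoc, ← Matrix.mul_kronecker_mul, sub_mul, hV.mul_eq, one_mul,
      sub_self, Matrix.zero_kronecker, mul_zero, Matrix.trace_zero, eq_comm, mul_eq_zero] at h1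
    have h2 := h1.resolve_left (by exact_mod_cast hμ.ne')
    rw [← Matrix.trace_conjTranspose_mul_self_eq_zero_iff, hX.1.eq, h2]
  rw [hcorner, add_zero] at hsum
  have hl : ((1 - V) ⊗ₖ (1 : Matrix (Fin m) (Fin m) ℂ)) * A = 0 := by
    rw [hsum, ← mul_assoc, ← mul_assoc, ← Matrix.mul_kronecker_mul, hVp.one_sub_mul,
      Matrix.zero_kronecker, zero_mul, zero_mul]
  have hr : ((1 : Matrix (Fin k) (Fin k) ℂ) ⊗ₖ (1 - W)) * A = 0 := by
    rw [hsum, ← mul_assoc, ← mul_assoc, ← Matrix.mul_kronecker_mul, hWp.one_sub_mul,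
      Matrix.kronecker_zero, zero_mul, zero_mul]
  constructor
  · obtain ⟨R, hR⟩ := hV.exists_eq_mul
    have h1 := h.mul_left_eq_zero hl i
    rw [sub_mul, one_mul, sub_eq_zero, hR, mul_assoc] at h1
    rw [h1]
    exact matrixImage_mul_le _ _
  · obtain ⟨R, hR⟩ := hW.exists_eq_mul
    have h1 := h.mul_right_eq_zero hr i
    rw [sub_mul, one_mul, sub_eq_zero, hR, mul_assoc] at h1
    rw [h1]
    exact matrixImage_mul_le _ _

/-- For a weakly irreducible matrix the singular vectors of the largest singular value are
semidefinite, and their images contain the images of all other singular vectors. -/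
theorem exists_posSemidef_eq_or_eq_neg (h : IsHermitianSchmidt A lam γ δ)
    (hA : IsWeakIrreducible A) (hred : IsCompletelyReducible A) {i : Fin n}
    (hi : ∀ j, lam j ≤ lam i) :
    (∃ X : Matrix (Fin k) (Fin k) ℂ, X.PosSemidef ∧ (γ i = X ∨ γ i = -X)) ∧
      ∀ j, matrixImage (γ j) ≤ matrixImage (γ i) ∧ matrixImage (δ j) ≤ matrixImage (δ i) := by
  obtain ⟨P, N, P', N', hP, hN, hP', hN', hγ, hδ, hPN, hNP, hpos, hneg⟩ :=
    h.exists_isSingularPair_posSemidef hA.1 hi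
  by_cases hP0 : P = 0
  · subst hP0
    obtain rfl := hpos.right_eq_zero (h.pos i)
    rw [zero_sub] at hγ hδ
    have hN0 : N ≠ 0 := fun h0 ↦ h.left_ne_zero i (by rw [hγ, h0, neg_zero])
    refine ⟨⟨N, hN, Or.inr hγ⟩, fun j ↦ ?_⟩
    rw [hγ, hδ, matrixImage_neg, matrixImage_neg]
    exact h.matrixImage_le_of_isSingularPair hA hred (h.pos i) hN hN' hN0 hneg j
  · have him := h.matrixImage_le_of_isSingularPair hA hred (h.pos i) hP hP' hP0 hpos
    -- The image of `γ i = P - N` lies in that of `P`, which `N` annihilates.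
    have hN0 : N = 0 := by
      have h1 := mul_eq_zero_of_matrixImage_le (him i).1 hNP
      rw [hγ, mul_sub, hNP, zero_sub, neg_eq_zero] at h1
      rw [← Matrix.conjTranspose_mul_self_eq_zero, hN.1.eq, h1]
    subst hN0
    obtain rfl := hneg.right_eq_zero (h.pos i)
    rw [sub_zero] at hγ hδ
    refine ⟨⟨P, hP, Or.inl hγ⟩, fun j ↦ ?_⟩
    rw [hγ, hδ]
    exact him j

/-- The largest singular value is simple because two orthogonal semidefinite matrices have product
zero, which is impossible if the image of one contains that of the other. -/
theorem dominatedByFirst (h : IsHermitianSchmidt A lam γ δ) (hlam : Antitone lam)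
    (hA : IsWeakIrreducible A) (hred : IsCompletelyReducible A) : DominatedByFirst lam γ δ := by
  intro f hf
  have hmax : ∀ j, lam j ≤ lam f := fun j ↦ hlam (Fin.le_def.mpr (hf ▸ Nat.zero_le _))
  obtain ⟨⟨X, hX, hγX⟩, him⟩ := h.exists_posSemidef_eq_or_eq_neg hA hred hmax
  refine ⟨fun i hi ↦ (hmax i).lt_of_ne fun heq ↦ ?_, fun i ↦ (him i).1, fun i ↦ (him i).2⟩
  obtain ⟨⟨Z, hZ, hγZ⟩, -⟩ := h.exists_posSemidef_eq_or_eq_neg hA hred (heq ▸ hmax)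
  have htr := h.trace_left_mul i f
  rw [if_neg hi] at htr
  have hZX : Z * X = 0 := by
    refine hZ.mul_eq_zero_of_trace_mul_eq_zero hX ?_
    rcases hγX with hγX | hγX <;> rcases hγZ with hγZ | hγZ <;> simpa [hγX, hγZ] using htr
  have hγγ : γ i * γ f = 0 := by
    rcases hγX with hγX | hγX <;> rcases hγZ with hγZ | hγZ <;> simp [hγX, hγZ, hZX]
  have h1 := mul_eq_zero_of_matrixImage_le (him i).1 hγγ
  have h2 := h.trace_left_mul i i
  rw [h1, if_pos rfl, Matrix.trace_zero] at h2
  exact zero_ne_one h2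

/-- If `A` is the sum of two complementary corners, then `V` multiplies `γ f` by `0` or by `1`, since
`lam f` is simple; by the inclusion of images it acts in the same way on every `γ i`. -/
theorem isWeakIrreducible (h : IsHermitianSchmidt A lam γ δ) (hA : A.PosSemidef)
    (hdom : DominatedByFirst lam γ δ) : IsWeakIrreducible A := by
  refine ⟨hA, fun V V' W W' hV hV' hW hW' hVV hWW hV1 hW1 hsum ↦ ?_⟩
  obtain rfl : V' = 1 - V := eq_sub_of_add_eq' hV1
  obtain rfl : W' = 1 - W := eq_sub_of_add_eq' hW1
  rcases Nat.eq_zero_or_pos n with rfl | hn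
  · left
    rw [h.eq_sum]
    simp
  obtain ⟨hlt, him, -⟩ := hdom ⟨0, hn⟩ rfl
  set f : Fin n := ⟨0, hn⟩
  have hl : (V ⊗ₖ (1 : Matrix (Fin m) (Fin m) ℂ)) * A = (V ⊗ₖ W) * A * (V ⊗ₖ W) := by
    conv_lhs => rw [hsum]
    rw [mul_add, ← mul_assoc, ← mul_assoc, ← mul_assoc, ← mul_assoc, ← Matrix.mul_kronecker_mul,
      ← Matrix.mul_kronecker_mul, hV.2, hVV, one_mul, Matrix.zero_kronecker, zero_mul, zero_mul,
      add_zero]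
  have hr : A * (V ⊗ₖ (1 : Matrix (Fin m) (Fin m) ℂ)) = (V ⊗ₖ W) * A * (V ⊗ₖ W) := by
    conv_lhs => rw [hsum]
    rw [add_mul, mul_assoc, mul_assoc _ _ (V ⊗ₖ 1), ← Matrix.mul_kronecker_mul,
      ← Matrix.mul_kronecker_mul, hV.2, hV.one_sub_mul, mul_one, Matrix.zero_kronecker, mul_zero,
      add_zero]
  have hl' : ((1 : Matrix (Fin k) (Fin k) ℂ) ⊗ₖ W) * A = (V ⊗ₖ W) * A * (V ⊗ₖ W) := by
    conv_lhs => rw [hsum]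
    rw [mul_add, ← mul_assoc, ← mul_assoc, ← mul_assoc, ← mul_assoc, ← Matrix.mul_kronecker_mul,
      ← Matrix.mul_kronecker_mul, hW.2, hWW, one_mul, Matrix.kronecker_zero, zero_mul, zero_mul,
      add_zero]
  have hr' : A * ((1 : Matrix (Fin k) (Fin k) ℂ) ⊗ₖ W) = (V ⊗ₖ W) * A * (V ⊗ₖ W) := by
    conv_lhs => rw [hsum]
    rw [add_mul, mul_assoc, mul_assoc _ _ (1 ⊗ₖ W), ← Matrix.mul_kronecker_mul,
      ← Matrix.mul_kronecker_mul, hW.2, hW.one_sub_mul, mul_one, Matrix.kronecker_zero, mul_zero,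
      add_zero]
  -- `V ⊗ 1` and `1 ⊗ W` act on `A` in the same way, so they map singular pairs to singular pairs.
  have hpair : IsSingularPair A (lam f) (V * γ f) (W * δ f) := by
    constructor <;> intro Z
    · rw [← one_mul Z, Matrix.mul_kronecker_mul, ← mul_assoc, hr, ← hl', mul_assoc,
        Matrix.trace_mul_comm, mul_assoc, ← Matrix.mul_kronecker_mul, mul_one, one_mul,
        (h.isSingularPair f).trace_left, ← mul_assoc, Matrix.trace_mul_comm, mul_assoc]
    · rw [← one_mul Z, Matrix.mul_kronecker_mul, ← mul_assoc, hr', ← hl, mul_assoc,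
        Matrix.trace_mul_comm, mul_assoc, ← Matrix.mul_kronecker_mul, mul_one, one_mul,
        (h.isSingularPair f).trace_right, ← mul_assoc, Matrix.trace_mul_comm, mul_assoc]
  obtain ⟨c, hc⟩ := h.exists_eq_smul (fun i hi ↦ (hlt i hi).ne) hpair
  have hc2 : (c * c - c) • γ f = 0 := by
    rw [sub_smul, mul_smul, ← hc, ← Matrix.mul_smul, ← hc, ← mul_assoc, hV.2, sub_self]
  rcases smul_eq_zero.mp hc2 with hc0 | hf0
  · rcases mul_eq_zero.mp (show c * (c - 1) = 0 by rw [← hc0]; ring) with hc | hc1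
    · subst hc
      rw [zero_smul] at hc
      left
      rw [← hl]
      exact h.kronecker_one_mul_eq_zero fun i ↦ mul_eq_zero_of_matrixImage_le (him i) hc
    · right
      obtain rfl : c = 1 := sub_eq_zero.mp hc1
      have h0 : (1 - V) * γ f = 0 := by rw [sub_mul, one_mul, hc, one_smul, sub_self]
      have h1 := h.kronecker_one_mul_eq_zero fun i ↦ mul_eq_zero_of_matrixImage_le (him i) h0
      rw [← one_mul (1 - V), ← mul_one (1 - W), Matrix.mul_kronecker_mul, mul_assoc _ _ A, h1,
        mul_zero, zero_mul]
  · exact absurd hf0 (h.left_ne_zero f)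

end IsHermitianSchmidt

/-! ### Complete reducibility of PPT matrices -/

theorem partialTranspose_mul {k m : ℕ} (A : Matrix (Fin k × Fin m) (Fin k × Fin m) ℂ)
    (X : Matrix (Fin k) (Fin k) ℂ) (Y : Matrix (Fin m) (Fin m) ℂ) :
    partialTranspose A * (X.transpose ⊗ₖ Y) =
      partialTranspose ((X ⊗ₖ (1 : Matrix (Fin m) (Fin m) ℂ)) * A *
        ((1 : Matrix (Fin k) (Fin k) ℂ) ⊗ₖ Y)) := by
  ext p q
  simp only [partialTranspose, Matrix.mul_apply, Fintype.sum_prod_type, Matrix.kroneckerMap_apply,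
    Matrix.one_apply, Matrix.of_apply, Matrix.transpose_apply, mul_ite, ite_mul, mul_one, one_mul,
    zero_mul, mul_zero, Finset.sum_ite_eq, Finset.mem_univ, if_true,
    Finset.sum_mul]
  rw [Finset.sum_comm]
  conv_rhs => rw [Finset.sum_comm]
  simp only [Finset.sum_ite_eq', Finset.mem_univ, if_true]
  exact Finset.sum_congr rfl fun _ _ ↦ Finset.sum_congr rfl fun _ _ ↦ by ring

theorem trace_partialTranspose {k m : ℕ} (A : Matrix (Fin k × Fin m) (Fin k × Fin m) ℂ) :
    (partialTranspose A).trace = A.trace := rfl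

theorem eq_zero_of_partialTranspose_eq_zero {k m : ℕ}
    {A : Matrix (Fin k × Fin m) (Fin k × Fin m) ℂ} (h : partialTranspose A = 0) : A = 0 := by
  ext p q
  exact congrFun₂ h (q.1, p.2) (p.1, q.2)

theorem IsPPT.isCompletelyReducible {k m : ℕ} {A : Matrix (Fin k × Fin m) (Fin k × Fin m) ℂ}
    (hA : IsPPT A) : IsCompletelyReducible A := by
  intro μ X V Y W hμ hX hY hXY hV hW
  -- The trace of this product is `tr (A (X ⊗ (1 - W))) = μ * tr (Y (1 - W)) = 0`.
  have h0 : partialTranspose A * (X.transpose ⊗ₖ (1 - W)) = 0 := by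
    refine hA.2.mul_eq_zero_of_trace_mul_eq_zero
      (hX.transpose.kronecker hW.isHermitianProjection.one_sub.posSemidef) ?_
    rw [partialTranspose_mul, trace_partialTranspose, mul_assoc, Matrix.trace_mul_comm, mul_assoc,
      ← Matrix.mul_kronecker_mul, one_mul, mul_one, hXY.trace_left, mul_sub,
      hW.mul_eq_right hY.1, mul_one, sub_self, Matrix.trace_zero, mul_zero]
  obtain ⟨R, hR⟩ := hV.exists_eq_mul_right hX.1
  have h1 : partialTranspose A * (V.transpose ⊗ₖ (1 - W)) = 0 := by
    rw [hR, Matrix.transpose_mul, ← mul_one (1 - W), Matrix.mul_kronecker_mul, ← mul_assoc, h0,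
      zero_mul]
  rw [partialTranspose_mul] at h1
  have h2 := eq_zero_of_partialTranspose_eq_zero h1
  calc (V ⊗ₖ W) * A * ((1 - V) ⊗ₖ (1 - W))
      = (1 ⊗ₖ W) * ((V ⊗ₖ 1) * A * (1 ⊗ₖ (1 - W))) * ((1 - V) ⊗ₖ 1) := by
        simp only [mul_assoc, ← Matrix.mul_kronecker_mul, one_mul, mul_one]
        simp only [← mul_assoc, ← Matrix.mul_kronecker_mul, one_mul, mul_one]
    _ = 0 := by rw [h2, mul_zero, zero_mul]

/-! ### Complete reducibility of SPC matrices -/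

/-- For an SPC matrix, `X - Y` would be an eigenvector of a positive semidefinite form for the
negative eigenvalue `-μ`. -/
theorem IsSPC.eq_of_isSingularPair {k : ℕ} {A : Matrix (Fin k × Fin k) (Fin k × Fin k) ℂ}
    (hA : IsSPC A) {μ : ℝ} (hμ : 0 < μ) {X Y : Matrix (Fin k) (Fin k) ℂ} (hX : X.IsHermitian)
    (hY : Y.IsHermitian) (hXY : IsSingularPair A μ X Y) : X = Y := by
  obtain ⟨-, n, lam, σ, h⟩ := hA
  have hsymm : ∀ Z, (A * (Y ⊗ₖ Z)).trace = (A * (Z ⊗ₖ Y)).trace := by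
    intro Z
    simp only [h.trace_mul_kronecker, mul_comm (Matrix.trace (_ * Z))]
  have hD : (X - Y).IsHermitian := hX.sub hY
  have h1 : (A * ((X - Y) ⊗ₖ (X - Y))).trace = -(μ * ((X - Y) * (X - Y)).trace) := by
    rw [Matrix.sub_kronecker, mul_sub, Matrix.trace_sub, hsymm, hXY.trace_left, hXY.trace_right,
      ← mul_sub, ← Matrix.trace_sub, ← sub_mul, ← neg_sub X Y, neg_mul, Matrix.trace_neg, mul_neg]
  have h2 : 0 ≤ (A * ((X - Y) ⊗ₖ (X - Y))).trace.re := by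
    rw [h.trace_mul_kronecker, Complex.re_sum]
    refine Finset.sum_nonneg fun i _ ↦ ?_
    rw [← (h.hermitian_left i).ofReal_re_trace_mul hD, ← Complex.ofReal_mul, ← Complex.ofReal_mul,
      Complex.ofReal_re]
    exact mul_nonneg (h.pos i).le (mul_self_nonneg _)
  refine sub_eq_zero.mp (hD.eq_zero_of_re_trace_mul_self ?_)
  rw [h1, Complex.neg_re, Complex.re_ofReal_mul] at h2
  exact nonpos_of_mul_nonpos_right (by linarith) hμ

theorem IsSPC.isCompletelyReducible {k : ℕ} {A : Matrix (Fin k × Fin k) (Fin k × Fin k) ℂ}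
    (hA : IsSPC A) : IsCompletelyReducible A := by
  intro μ X V Y W hμ hX hY hXY hV hW
  have hcorner := hXY.mul_kronecker_one_sub_eq_zero hA.1 hX hY hV hW
  obtain rfl := hA.eq_of_isSingularPair hμ hX.1 hY.1 hXY
  obtain rfl := hV.unique hW
  obtain ⟨-, n, lam, σ, h⟩ := hA
  have hVh := hV.isHermitianProjection.1
  have hVh' := hV.isHermitianProjection.one_sub.1
  have hzero : ∀ j, V * σ j * (1 - V) = 0 := by
    intro j
    -- Pairing `A (V ⊗ (1 - V)) = 0` with `B j ⊗ (B j)ᴴ` gives a sum of nonnegative terms.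
    set B := fun i ↦ V * σ i * (1 - V) with hB
    have hBs : ∀ i, (B i).conjTranspose = (1 - V) * σ i * V := by
      intro i
      rw [hB, Matrix.conjTranspose_mul, Matrix.conjTranspose_mul, hVh.eq, hVh'.eq,
        (h.hermitian_left i).eq, mul_assoc]
    have h1 : (A * ((V * B j * (1 - V)) ⊗ₖ ((1 - V) * (B j).conjTranspose * V))).trace = 0 := by
      rw [mul_assoc V, mul_assoc (1 - V), Matrix.mul_kronecker_mul, ← mul_assoc, hcorner, zero_mul,
        Matrix.trace_zero]
    have h2 : ∀ i, (σ i * (V * B j * (1 - V))).trace = star ((B i * (B j).conjTranspose).trace) := by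
      intro i
      rw [← Matrix.trace_conjTranspose, Matrix.conjTranspose_mul, Matrix.conjTranspose_conjTranspose,
        hBs, ← mul_assoc, Matrix.trace_mul_comm, ← mul_assoc, ← mul_assoc, Matrix.trace_mul_comm]
    have h3 : ∀ i, (σ i * ((1 - V) * (B j).conjTranspose * V)).trace =
        (B i * (B j).conjTranspose).trace := by
      intro i
      rw [← mul_assoc, Matrix.trace_mul_comm, ← mul_assoc, ← mul_assoc, hB]
    have h4 : ∑ i, lam i * Complex.normSq (B i * (B j).conjTranspose).trace = 0 := by
      rw [h.trace_mul_kronecker] at h1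
      simp only [h2, h3] at h1
      rw [← Complex.ofReal_inj]
      push_cast
      simpa only [Complex.normSq_eq_conj_mul_self, starRingEnd_apply] using h1
    have h5 := (Finset.sum_eq_zero_iff_of_nonneg fun i _ ↦
      mul_nonneg (h.pos i).le (Complex.normSq_nonneg _)).mp h4 j (Finset.mem_univ j)
    have h6 := Complex.normSq_eq_zero.mp ((mul_eq_zero.mp h5).resolve_left (h.pos j).ne')
    exact Matrix.trace_mul_conjTranspose_self_eq_zero_iff.mp h6
  rw [h.eq_sum, Finset.mul_sum, Finset.sum_mul]
  refine Finset.sum_eq_zero fun i _ ↦ ?_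
  rw [Matrix.mul_smul, Matrix.smul_mul, ← Matrix.mul_kronecker_mul, ← Matrix.mul_kronecker_mul,
    hzero, Matrix.zero_kronecker, smul_zero]

/-! ### Description of weakly irreducible matrices -/

theorem mainTheorem1 :
    (∀ (k : ℕ) (A : Matrix (Fin k × Fin k) (Fin k × Fin k) ℂ), IsSPC A →
      (∃ (n : ℕ) (lam : Fin n → ℝ) (γ δ : Fin n → Matrix (Fin k) (Fin k) ℂ),
        IsHermitianSchmidt A lam γ δ ∧ Antitone lam) ∧
      ∀ (n : ℕ) (lam : Fin n → ℝ) (γ δ : Fin n → Matrix (Fin k) (Fin k) ℂ),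
        IsHermitianSchmidt A lam γ δ → Antitone lam →
          (IsWeakIrreducible A ↔ DominatedByFirst lam γ δ)) ∧
    (∀ (k m : ℕ) (A : Matrix (Fin k × Fin m) (Fin k × Fin m) ℂ), IsPPT A →
      (∃ (n : ℕ) (lam : Fin n → ℝ) (γ : Fin n → Matrix (Fin k) (Fin k) ℂ)
        (δ : Fin n → Matrix (Fin m) (Fin m) ℂ),
        IsHermitianSchmidt A lam γ δ ∧ Antitone lam) ∧
      ∀ (n : ℕ) (lam : Fin n → ℝ) (γ : Fin n → Matrix (Fin k) (Fin k) ℂ)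
        (δ : Fin n → Matrix (Fin m) (Fin m) ℂ),
        IsHermitianSchmidt A lam γ δ → Antitone lam →
          (IsWeakIrreducible A ↔ DominatedByFirst lam γ δ)) := by
  refine ⟨fun k A hA ↦ ⟨exists_isHermitianSchmidt hA.1.1, fun n lam γ δ h hlam ↦
      ⟨fun hw ↦ h.dominatedByFirst hlam hw hA.isCompletelyReducible, h.isWeakIrreducible hA.1⟩⟩,
    fun k m A hA ↦ ⟨exists_isHermitianSchmidt hA.1.1, fun n lam γ δ h hlam ↦
      ⟨fun hw ↦ h.dominatedByFirst hlam hw hA.isCompletelyReducible, h.isWeakIrreducible hA.1⟩⟩⟩
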